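/- Let $k$ be an odd positive integer and let $\chi$ be a real, even, primitive, nonprincipal Dirichlet character modulo $k$. For every nonnegative integer $a$ and every even positive integer $b$ define $$S_1(a,b,\chi) := \sum_{0<n<k/2}\chi(n)\,\frac{\cos^a(b\pi n/k)}{\cos^2(\pi n/k)},\qquad E(a,b,\chi) := \frac{1}{2^{a-2}}\sum_{\substack{n,j,r\ge 0\\ 2(n+j+br)=ab}}(-1)^j\, j\,\chi(n)\binom{a}{r},$$ where the second sum is over all nonnegative integers $n,j,r$ with $2(n+j+br)=ab$, and $$g(\chi) := \sum_{j=1}^{k-1}(-1)^j\, j\,\chi(j).$$ Then $$S_1(a,b,\chi) = -\sqrt{k}\,\Bigl((-1)^{ab/2}g(\chi)+E(a,b,\chi)\Bigr).$$ -/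

import Mathlib

namespace CosCharSum

/-- `S₁(a, b, χ) = ∑_{0 < n < k/2} χ(n) cos^a(bπn/k) / cos²(πn/k)`. -/
noncomputable def S₁ {k : ℕ} (a b : ℕ) (χ : DirichletCharacter ℂ k) : ℂ :=
  ∑ n ∈ (Finset.range k).filter (fun n : ℕ => 0 < n ∧ (n : ℝ) < (k : ℝ) / 2),
    χ (n : ZMod k) *
      ((Real.cos (b * Real.pi * n / k) ^ a / Real.cos (Real.pi * n / k) ^ 2 : ℝ) : ℂ)

/-- The triples `(n, j, r)` of nonnegative integers with `2 (n + j + b r) = a b`. For `b > 0` all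
such triples lie in the box used here, see `mem_triples`. -/
def triples (a b : ℕ) : Finset (ℕ × ℕ × ℕ) :=
  (Finset.range (a * b + 1) ×ˢ Finset.range (a * b + 1) ×ˢ Finset.range (a * b + 1)).filter
    (fun p => 2 * (p.1 + p.2.1 + b * p.2.2) = a * b)

theorem mem_triples {a b : ℕ} (hb : 0 < b) (n j r : ℕ) :
    (n, j, r) ∈ triples a b ↔ 2 * (n + j + b * r) = a * b := by
  simp only [triples, Finset.mem_filter, Finset.mem_product, Finset.mem_range]
  refine ⟨fun h => h.2, fun h => ⟨?_, h⟩⟩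
  have hr : r ≤ b * r := Nat.le_mul_of_pos_left r hb
  omega

/-- `E(a, b, χ) = 2^{-(a-2)} ∑ (-1)^j j χ(n) (a choose r)`, over all nonnegative integers
`n, j, r` with `2 (n + j + b r) = a b`. The exponent `a - 2` is an integer, possibly negative. -/
noncomputable def E {k : ℕ} (a b : ℕ) (χ : DirichletCharacter ℂ k) : ℂ :=
  1 / (2 : ℂ) ^ ((a : ℤ) - 2) *
    ∑ p ∈ triples a b,
      (-1 : ℂ) ^ p.2.1 * (p.2.1 : ℂ) * χ (p.1 : ZMod k) * (Nat.choose a p.2.2 : ℂ)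

/-- `g(χ) = ∑_{j=1}^{k-1} (-1)^j j χ(j)`. -/
noncomputable def g {k : ℕ} (χ : DirichletCharacter ℂ k) : ℂ :=
  ∑ j ∈ Finset.Ico 1 k, (-1 : ℂ) ^ j * (j : ℂ) * χ (j : ZMod k)

end CosCharSum

/-! Put T(m) = ½ ∑ χ(x) e(mx/k) / cos²(πx/k) (`twistedSum`). Since 4cos²(πx/k) = 2 + e(x/k) +
e(-x/k), applying the squared operator (1 + shift)² to T clears the denominator and leaves a Gauss
sum: T(m+1) + 2T(m) + T(m-1) = 2√k χ(m). As T is even, this solves to T(m) = (-1)^m T(0) - 2√k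
`altConv χ m`; taking m = k, which is odd, forces T(0) = -√k g(χ). Binomial expansion of cos^a
writes `S₁` through values of T, and the `altConv` terms assemble into `E`.

The delicate input is that the Gauss sum of χ is +√k and not -√k. Gauss's q-binomial identity turns
the quadratic Gauss sum into a product of sines with nonnegative real part, and
`gaussSum_real_eq_sqrt` transfers this sign to χ. -/

namespace CosCharSum

open Finset

/-! ### Gauss's alternating q-binomial sum -/

section QBinomial

variable {F : Type*} [Field F]

/-- The Gaussian binomial coefficient `[n, j]_q`. -/
def qBinom (q : F) : ℕ → ℕ → F
  | _, 0 => 1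
  | 0, _ + 1 => 0
  | n + 1, j + 1 => qBinom q n j + q ^ (j + 1) * qBinom q n (j + 1)

@[simp] lemma qBinom_zero_right (q : F) (n : ℕ) : qBinom q n 0 = 1 := by cases n <;> rfl

@[simp] lemma qBinom_zero_succ (q : F) (j : ℕ) : qBinom q 0 (j + 1) = 0 := rfl

lemma qBinom_succ_succ (q : F) (n j : ℕ) :
    qBinom q (n + 1) (j + 1) = qBinom q n j + q ^ (j + 1) * qBinom q n (j + 1) := rfl

lemma qBinom_eq_zero (q : F) {n j : ℕ} (h : n < j) : qBinom q n j = 0 := by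
  induction n generalizing j with
  | zero => obtain ⟨j, rfl⟩ := Nat.exists_eq_succ_of_ne_zero h.ne'; rfl
  | succ n ih =>
    obtain ⟨j, rfl⟩ := Nat.exists_eq_succ_of_ne_zero (Nat.ne_zero_of_lt h)
    rw [Nat.succ_eq_add_one, qBinom_succ_succ, ih (by omega), ih (by omega)]
    simp

/-- The ratio of neighbouring coefficients with denominators cleared, so that it survives at roots
of unity. -/
lemma qBinom_absorb (q : F) (n j : ℕ) :
    (q ^ j - q ^ n) * qBinom q n j = q ^ j * (1 - q ^ (j + 1)) * qBinom q n (j + 1) := by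
  induction n generalizing j with
  | zero => cases j <;> simp
  | succ n ih =>
    cases j with
    | zero =>
      have h0 := ih 0
      simp only [qBinom_succ_succ, qBinom_zero_right] at h0 ⊢
      linear_combination q * h0
    | succ j =>
      have h0 := ih j
      have h1 := ih (j + 1)
      simp only [qBinom_succ_succ]
      linear_combination q * h0 + q ^ (j + 2) * h1

lemma qBinom_pascal (q : F) (n j : ℕ) :
    q ^ (j + 1) * qBinom q (n + 1) (j + 1)
      = q ^ (n + 1) * qBinom q n j + q ^ (j + 1) * qBinom q n (j + 1) := by
  rw [qBinom_succ_succ]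
  linear_combination q * qBinom_absorb q n j

/-- The alternating sum of the Gaussian binomial coefficients. -/
def qAltSum (q : F) (n : ℕ) : F := ∑ j ∈ range (n + 1), (-1) ^ j * qBinom q n j

/-- The alternating sum of the Gaussian binomial coefficients with weights `q ^ j`. -/
def qAltWeightedSum (q : F) (n : ℕ) : F :=
  ∑ j ∈ range (n + 1), (-1) ^ j * (q ^ j * qBinom q n j)

lemma qAltSum_succ (q : F) (n : ℕ) :
    qAltSum q (n + 1) = qAltWeightedSum q n - qAltSum q n := by
  have h : qAltWeightedSum q n
      = ∑ j ∈ range (n + 1), (-1) ^ (j + 1) * (q ^ (j + 1) * qBinom q n (j + 1)) + 1 := by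
    rw [sum_range_succ, qAltWeightedSum, sum_range_succ', qBinom_eq_zero q (Nat.lt_succ_self n)]
    simp
  rw [h, qAltSum, sum_range_succ', qAltSum, add_sub_right_comm, ← sum_sub_distrib]
  congr 1
  · refine sum_congr rfl fun j _ => ?_
    rw [qBinom_succ_succ]; ring
  · simp

lemma qAltWeightedSum_succ (q : F) (n : ℕ) :
    qAltWeightedSum q (n + 1) = qAltWeightedSum q n - q ^ (n + 1) * qAltSum q n := by
  have h : qAltWeightedSum q n
      = ∑ j ∈ range (n + 1), (-1) ^ (j + 1) * (q ^ (j + 1) * qBinom q n (j + 1)) + 1 := by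
    rw [sum_range_succ, qAltWeightedSum, sum_range_succ', qBinom_eq_zero q (Nat.lt_succ_self n)]
    simp
  rw [h, qAltWeightedSum, sum_range_succ', qAltSum, mul_sum, add_sub_right_comm,
    ← sum_sub_distrib]
  congr 1
  · refine sum_congr rfl fun j _ => ?_
    rw [qBinom_pascal]; ring
  · simp

/-- Eliminating the weighted sum from the two recurrences gives a factor `1 - q ^ (n + 1)` for each
double step. -/
lemma qAltSum_two_mul (q : F) (h : ℕ) :
    qAltSum q (2 * h) = ∏ l ∈ range h, (1 - q ^ (2 * l + 1)) := by
  induction h with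
  | zero => simp [qAltSum]
  | succ h ih =>
    rw [prod_range_succ, ← ih, mul_add, mul_one, qAltSum_succ, qAltSum_succ,
      qAltWeightedSum_succ]
    ring

/-- With q = w⁻² of order n + 1, q^n = q⁻¹, so absorption collapses to q^(j+1) [n, j+1] = -[n, j].
-/
lemma neg_one_pow_mul_qBinom {w : F} {n : ℕ} (hn : Odd (n + 1)) (hw : IsPrimitiveRoot w (n + 1))
    {j : ℕ} (hj : j ≤ n) :
    (-1) ^ j * qBinom (w⁻¹ ^ 2) n j = w ^ (j * (j + 1)) := by
  have hw0 : w ≠ 0 := hw.ne_zero (Nat.succ_ne_zero n)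
  have hq : IsPrimitiveRoot (w⁻¹ ^ 2) (n + 1) :=
    hw.inv.pow_of_coprime 2 (Nat.coprime_two_left.mpr hn)
  induction j with
  | zero => simp
  | succ j ih =>
    have ih := ih (by omega)
    have hab := qBinom_absorb (w⁻¹ ^ 2) n j
    have h1 : 1 - (w⁻¹ ^ 2) ^ (j + 1) ≠ 0 :=
      sub_ne_zero.mpr (hq.pow_ne_one_of_pos_of_lt (Nat.succ_ne_zero j) (by omega)).symm
    have hn1 : (w⁻¹ ^ 2) ^ n * w⁻¹ ^ 2 = 1 := by rw [← pow_succ, hq.pow_eq_one]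
    have key : (w⁻¹ ^ 2) ^ (j + 1) * qBinom (w⁻¹ ^ 2) n (j + 1) = - qBinom (w⁻¹ ^ 2) n j := by
      apply mul_left_cancel₀ h1
      linear_combination -(w⁻¹ ^ 2) * hab - qBinom (w⁻¹ ^ 2) n j * hn1
    have hp : w ^ (2 * (j + 1)) * (w⁻¹ ^ 2) ^ (j + 1) = 1 := by
      rw [← pow_mul, inv_pow, mul_inv_cancel₀ (pow_ne_zero _ hw0)]
    have e : w ^ ((j + 1) * (j + 1 + 1)) = w ^ (j * (j + 1)) * w ^ (2 * (j + 1)) := by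
      rw [← pow_add]; congr 1; ring
    rw [e, ← ih]
    linear_combination (-1) ^ (j + 1) * (w ^ (2 * (j + 1)) * key
      - qBinom (w⁻¹ ^ 2) n (j + 1) * hp)

lemma sum_pow_mul_succ_eq_prod {w : F} {h : ℕ} (hw : IsPrimitiveRoot w (2 * h + 1)) :
    ∑ j ∈ range (2 * h + 1), w ^ (j * (j + 1))
      = ∏ l ∈ range h, (1 - (w⁻¹ ^ 2) ^ (2 * l + 1)) := by
  rw [← qAltSum_two_mul, qAltSum]
  refine sum_congr rfl fun j hj => ?_
  rw [neg_one_pow_mul_qBinom ⟨h, rfl⟩ hw (Nat.lt_succ_iff.mp (mem_range.mp hj))]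

end QBinomial

lemma sum_zmod_eq_sum_range {M : Type*} [AddCommMonoid M] (k : ℕ) [NeZero k] (f : ZMod k → M) :
    ∑ x, f x = ∑ n ∈ range k, f n := by
  symm
  refine sum_bij' (fun n _ => (n : ZMod k)) (fun x _ => x.val) ?_ ?_ ?_ ?_ ?_
  · simp
  · intro x _; simpa using ZMod.val_lt x
  · intro n hn; exact ZMod.val_cast_of_lt (by simpa using hn)
  · intro x _; simp
  · simp

open ZMod

/-! ### Quadratic Gauss sums: product formula and modulus -/

section GaussSums

variable {k : ℕ} [NeZero k]

/-- The quadratic Gauss sum `∑ x, e(u x² / k)`. -/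
noncomputable def quadGaussSum (u : ZMod k) : ℂ := ∑ x : ZMod k, stdAddChar (u * x ^ 2)

lemma isPrimitiveRoot_stdAddChar_one : IsPrimitiveRoot (stdAddChar (1 : ZMod k)) k := by
  have h : stdAddChar (1 : ZMod k) = Complex.exp (2 * Real.pi * Complex.I / k) := by
    simpa using stdAddChar_coe (N := k) 1
  rw [h]
  exact Complex.isPrimitiveRoot_exp k (NeZero.ne k)

lemma stdAddChar_natCast (n : ℕ) :
    stdAddChar (n : ZMod k) = stdAddChar (1 : ZMod k) ^ n := by
  rw [← AddChar.map_nsmul_eq_pow]; simp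

lemma quadGaussSum_one_eq_prod {h : ℕ} (hk : k = 2 * h + 1) :
    quadGaussSum (1 : ZMod k)
      = ∏ l ∈ range h, (2 * Complex.I * (Real.sin (2 * Real.pi * (2 * l + 1) / k) : ℂ)) := by
  set w : ℂ := stdAddChar (1 : ZMod k) with hwdef
  have hw : IsPrimitiveRoot w k := isPrimitiveRoot_stdAddChar_one
  have hw0 : w ≠ 0 := hw.ne_zero (NeZero.ne k)
  have hk0 : ((2 * h + 1 : ℕ) : ZMod k) = 0 := by rw [← hk]; simp
  push_cast at hk0
  have h1 : quadGaussSum (1 : ZMod k)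
      = w ^ ((h + 1) ^ 2) * ∑ j ∈ range k, w ^ (j * (j + 1)) := by
    -- `h + 1` is the inverse of 2 modulo `k`; this shift completes the square.
    rw [quadGaussSum, ← Equiv.sum_comp (Equiv.addRight ((h : ZMod k) + 1)), sum_zmod_eq_sum_range,
      mul_sum]
    refine sum_congr rfl fun n _ => ?_
    have : (1 : ZMod k) * (Equiv.addRight ((h : ZMod k) + 1) (n : ZMod k)) ^ 2
        = (((h + 1) ^ 2 + n * (n + 1) : ℕ) : ZMod k) := by
      push_cast
      simp only [Equiv.coe_addRight]
      linear_combination (n : ZMod k) * hk0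
    rw [this, stdAddChar_natCast, pow_add]
  have hodd : w ^ (h ^ 2) = ∏ l ∈ range h, w ^ (2 * l + 1) := by
    rw [prod_pow_eq_pow_sum]
    congr 1
    clear_value w
    clear h1 hw hk0 hw0 hwdef hk
    induction h with
    | zero => simp
    | succ h ih => rw [sum_range_succ, ← ih]; ring
  have h2 : w ^ ((h + 1) ^ 2) = w ^ (h ^ 2) := by
    have : (h + 1) ^ 2 = h ^ 2 + k := by rw [hk]; ring
    rw [this, pow_add, hw.pow_eq_one, mul_one]
  rw [h1, h2, hodd]
  have h3 := sum_pow_mul_succ_eq_prod (w := w) (h := h) (hk ▸ hw)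
  rw [← hk] at h3
  rw [h3, ← prod_mul_distrib]
  refine prod_congr rfl fun l _ => ?_
  have hexp : w ^ (2 * l + 1)
      = Complex.exp (((2 * Real.pi * (2 * l + 1) / k : ℝ) : ℂ) * Complex.I) := by
    rw [hwdef, ← stdAddChar_natCast]
    have := stdAddChar_coe (N := k) ((2 * l + 1 : ℕ) : ℤ)
    rw [Int.cast_natCast] at this
    rw [this]
    congr 1
    push_cast
    ring
  have h4 : w ^ (2 * l + 1) * (1 - (w⁻¹ ^ 2) ^ (2 * l + 1))
      = w ^ (2 * l + 1) - (w ^ (2 * l + 1))⁻¹ := by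
    rw [← pow_mul, mul_comm 2 (2 * l + 1), pow_mul, inv_pow]
    have := pow_ne_zero (2 * l + 1) hw0
    field_simp
  rw [h4, hexp, ← Complex.exp_neg, Complex.ofReal_sin, Complex.sin]
  rw [neg_mul]
  ring_nf
  simp only [Complex.I_sq]
  ring

/-- For h odd the product is purely imaginary; for h = 2r the last r sines are nonpositive and
absorb the sign (-1)^r. -/
lemma quadGaussSum_one_re_nonneg (hk : Odd k) : 0 ≤ (quadGaussSum (1 : ZMod k)).re := by
  obtain ⟨h, hh⟩ := hk
  have hk0 : (0 : ℝ) < k := Nat.cast_pos.mpr (NeZero.pos k)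
  have hkr : (k : ℝ) = 2 * h + 1 := by rw [hh]; push_cast; ring
  rw [quadGaussSum_one_eq_prod hh, prod_mul_distrib, prod_const, card_range, mul_pow,
    ← Complex.ofReal_prod]
  obtain ⟨r, hr | hr⟩ := Nat.even_or_odd' h
  · subst hr
    have e : (2 : ℂ) ^ (2 * r) * Complex.I ^ (2 * r) = (((2 : ℝ) ^ (2 * r) * (-1) ^ r : ℝ) : ℂ) := by
      rw [pow_mul Complex.I, Complex.I_sq]; push_cast; ring
    rw [e, ← Complex.ofReal_mul, Complex.ofReal_re, mul_assoc]
    refine mul_nonneg (by positivity) ?_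
    rw [two_mul r, prod_range_add, mul_left_comm]
    have e2 : ((-1 : ℝ)) ^ r = ∏ _l ∈ range r, (-1 : ℝ) := by simp
    rw [e2, ← prod_mul_distrib]
    push_cast at hkr
    refine mul_nonneg (prod_nonneg fun l hl => ?_) (prod_nonneg fun l hl => ?_)
    · have hl' : (l : ℝ) + 1 ≤ r := by exact_mod_cast mem_range.mp hl
      have hl0 : (0 : ℝ) ≤ l := Nat.cast_nonneg l
      apply Real.sin_nonneg_of_nonneg_of_le_pi (by positivity)
      rw [div_le_iff₀ hk0]
      nlinarith [Real.pi_pos]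
    · have hl' : (l : ℝ) + 1 ≤ r := by exact_mod_cast mem_range.mp hl
      have hl0 : (0 : ℝ) ≤ l := Nat.cast_nonneg l
      rw [neg_one_mul, neg_nonneg, ← Real.sin_sub_two_pi]
      apply Real.sin_nonpos_of_nonpos_of_neg_pi_le
      · rw [sub_nonpos, div_le_iff₀ hk0]
        push_cast
        nlinarith [Real.pi_pos]
      · rw [neg_le_sub_iff_le_add, ← sub_le_iff_le_add, le_div_iff₀ hk0]
        push_cast
        nlinarith [Real.pi_pos]
  · have e : (2 : ℂ) ^ h * Complex.I ^ h
        = (((2 : ℝ) ^ h * (-1) ^ r : ℝ) : ℂ) * Complex.I := by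
      rw [hr, pow_succ Complex.I, pow_mul Complex.I, Complex.I_sq]; push_cast; ring
    rw [e, Complex.re_mul_ofReal, Complex.re_ofReal_mul, Complex.I_re]
    simp

lemma sum_stdAddChar_mul (t : ZMod k) :
    ∑ x : ZMod k, stdAddChar (x * t) = if t = 0 then (k : ℂ) else 0 := by
  rw [AddChar.sum_mulShift t (isPrimitive_stdAddChar k), ZMod.card]
  split_ifs <;> simp

lemma conj_stdAddChar (x : ZMod k) :
    (starRingEnd ℂ) (stdAddChar x) = stdAddChar (-x) := by
  rw [stdAddChar_apply, stdAddChar_apply, AddChar.map_neg_eq_inv, Circle.coe_inv_eq_conj]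

/-- After x = y + d the variable y occurs linearly, and since 2u is a unit orthogonality leaves only
d = 0. -/
lemma normSq_quadGaussSum (hk : Odd k) {u : ZMod k} (hu : IsUnit u) :
    Complex.normSq (quadGaussSum u) = k := by
  have h2 : IsUnit (2 : ZMod k) := by
    have := (ZMod.isUnit_iff_coprime 2 k).mpr (Nat.coprime_two_left.mpr hk)
    simpa using this
  apply Complex.ofReal_injective
  rw [Complex.normSq_eq_conj_mul_self, quadGaussSum, map_sum, sum_mul]
  have h (y : ZMod k) : (starRingEnd ℂ) (stdAddChar (u * y ^ 2)) * ∑ x, stdAddChar (u * x ^ 2)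
      = ∑ d : ZMod k, stdAddChar (u * d ^ 2) * stdAddChar (y * (2 * u * d)) := by
    rw [← Equiv.sum_comp (Equiv.addLeft y), mul_sum]
    refine sum_congr rfl fun d _ => ?_
    rw [conj_stdAddChar, ← AddChar.map_add_eq_mul, ← AddChar.map_add_eq_mul]
    congr 1
    simp only [Equiv.coe_addLeft]
    ring
  simp only [h]
  rw [sum_comm]
  simp only [← mul_sum, sum_stdAddChar_mul, (h2.mul hu).mul_right_eq_zero]
  simp

end GaussSums

/-! ### The Gauss sum of a real even primitive character -/

section RealCharacter

variable {k : ℕ} {χ : DirichletCharacter ℂ k}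

lemma real_sq_eq_one (hreal : ∀ x, (χ x).im = 0) {x : ZMod k} (hx : IsUnit x) : χ x ^ 2 = 1 := by
  have h1 : ‖χ x‖ = 1 := by simpa using χ.unit_norm_eq_one hx.unit
  have h2 : χ x = ((χ x).re : ℂ) := Complex.ext rfl (by simp [hreal])
  rw [h2, Complex.norm_real, Real.norm_eq_abs] at h1
  rw [h2, ← Complex.ofReal_pow, ← sq_abs, h1]
  simp

lemma real_inv_eq (hreal : ∀ x, (χ x).im = 0) : χ⁻¹ = χ := by
  ext u
  have h := real_sq_eq_one hreal u.isUnit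
  rw [MulChar.inv_apply_eq_inv']
  exact inv_eq_of_mul_eq_one_left (by rw [← sq, h])

variable [NeZero k]

lemma gaussSum_mulShift_real (hreal : ∀ x, (χ x).im = 0) (hprim : χ.IsPrimitive) (m : ZMod k) :
    ∑ x, χ x * stdAddChar (m * x) = χ m * gaussSum χ stdAddChar := by
  have h := gaussSum_mulShift_of_isPrimitive stdAddChar hprim m
  rw [real_inv_eq hreal] at h
  rw [← h, gaussSum]
  rfl

lemma gaussSum_sq (hreal : ∀ x, (χ x).im = 0) (heven : χ.Even) (hprim : χ.IsPrimitive) :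
    gaussSum χ stdAddChar ^ 2 = (k : ℂ) := by
  -- Fourier inversion for `χ`, evaluated at 1.
  have h : ∑ a : ZMod k, stdAddChar (-a) * ∑ x, χ x * stdAddChar (a * x) = k := by
    simp only [mul_sum]
    rw [sum_comm]
    have (x : ZMod k) : ∑ a : ZMod k, stdAddChar (-a) * (χ x * stdAddChar (a * x))
        = χ x * if x = 1 then (k : ℂ) else 0 := by
      simp only [← sub_eq_zero (a := x)]
      rw [← sum_stdAddChar_mul, mul_sum]
      refine sum_congr rfl fun a _ => ?_
      rw [mul_left_comm, ← AddChar.map_add_eq_mul]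
      congr 2
      ring
    simp [this]
  simp only [gaussSum_mulShift_real hreal hprim] at h
  rw [← h, ← Equiv.sum_comp (Equiv.neg (ZMod k)), sq]
  conv_lhs => enter [1]; rw [gaussSum]
  rw [sum_mul]
  refine sum_congr rfl fun a _ => ?_
  rw [Equiv.neg_apply, neg_neg, heven.eval_neg]
  ring

/-- With G the quadratic Gauss sum, the terms χ(y) G(y) τ have modulus k at units and add up to k ∑
χ(y)², so each has real part exactly k there. At y = 1 this excludes τ = -√k, because Re G(1) ≥ 0.
-/
lemma gaussSum_real_eq_sqrt (hk : Odd k) (hreal : ∀ x, (χ x).im = 0) (heven : χ.Even)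
    (hprim : χ.IsPrimitive) : gaussSum χ stdAddChar = ((Real.sqrt k : ℝ) : ℂ) := by
  set τ := gaussSum χ stdAddChar with hτ
  have hsq : τ ^ 2 = k := gaussSum_sq hreal heven hprim
  have hs2 : Real.sqrt k ^ 2 = k := Real.sq_sqrt (Nat.cast_nonneg k)
  have hspos : 0 < Real.sqrt k := Real.sqrt_pos.mpr (Nat.cast_pos.mpr (NeZero.pos k))
  have hor : τ = ((Real.sqrt k : ℝ) : ℂ) ∨ τ = -((Real.sqrt k : ℝ) : ℂ) := by
    apply sq_eq_sq_iff_eq_or_eq_neg.mp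
    rw [hsq, ← Complex.ofReal_pow, hs2]; simp
  have hsum : ∑ y, χ y * quadGaussSum y = τ * ∑ x, χ x ^ 2 := by
    simp only [quadGaussSum, mul_sum]
    rw [sum_comm]
    refine sum_congr rfl fun x _ => ?_
    rw [← map_pow, mul_comm τ, ← gaussSum_mulShift_real hreal hprim]
    exact sum_congr rfl fun y _ => by rw [mul_comm y]
  have hzero : ∑ y, ((k : ℂ) * χ y ^ 2 - χ y * quadGaussSum y * τ) = 0 := by
    rw [sum_sub_distrib, ← mul_sum, ← sum_mul, hsum, ← hsq]; ring
  have hτn : ‖τ‖ = Real.sqrt k := by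
    rcases hor with h | h <;> simp [h, abs_of_pos hspos]
  have hnonneg : ∀ y ∈ (univ : Finset (ZMod k)),
      0 ≤ ((k : ℂ) * χ y ^ 2 - χ y * quadGaussSum y * τ).re := by
    intro y _
    by_cases hy : IsUnit y
    · rw [real_sq_eq_one hreal hy, mul_one, Complex.sub_re, Complex.natCast_re, sub_nonneg]
      refine (Complex.re_le_norm _).trans ?_
      have h1 : ‖χ y‖ = 1 := by simpa using χ.unit_norm_eq_one hy.unit
      have h2 : ‖quadGaussSum y‖ = Real.sqrt k := by
        rw [Complex.norm_def, normSq_quadGaussSum hk hy]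
      rw [norm_mul, norm_mul, h1, h2, hτn, one_mul, ← sq, hs2]
    · simp [χ.map_nonunit hy]
  have hre := congrArg Complex.re hzero
  rw [Complex.re_sum, Complex.zero_re] at hre
  have h1 := (sum_eq_zero_iff_of_nonneg hnonneg).mp hre 1 (mem_univ _)
  rcases hor with h | h
  · exact h
  · exfalso
    rw [map_one, h] at h1
    have h3 := quadGaussSum_one_re_nonneg (k := k) hk
    simp at h1
    have hk0 : (0 : ℝ) < k := Nat.cast_pos.mpr (NeZero.pos k)
    nlinarith [mul_nonneg h3 hspos.le]

end RealCharacter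

end CosCharSum

namespace CosCharSum

open Finset ZMod

/-! ### Alternating convolutions and `E` -/

section Convolutions

variable {k : ℕ}

/-- The convolution `∑_{n + j = m} (-1)^j j χ(n)`. -/
noncomputable def altConv (χ : DirichletCharacter ℂ k) (m : ℕ) : ℂ :=
  ∑ p ∈ antidiagonal m, (-1 : ℂ) ^ p.2 * (p.2 : ℂ) * χ (p.1 : ZMod k)

/-- The convolution `∑_{n + j = m} (-1)^j χ(n)`. -/
noncomputable def altSum (χ : DirichletCharacter ℂ k) (m : ℕ) : ℂ :=
  ∑ p ∈ antidiagonal m, (-1 : ℂ) ^ p.2 * χ (p.1 : ZMod k)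

variable {χ : DirichletCharacter ℂ k}

lemma altConv_zero : altConv χ 0 = 0 := by simp [altConv]

lemma altConv_succ (m : ℕ) : altConv χ (m + 1) = -altConv χ m - altSum χ m := by
  rw [altConv, Nat.sum_antidiagonal_succ', altConv, altSum, ← sum_neg_distrib,
    ← sum_sub_distrib]
  simp only [Nat.cast_zero, mul_zero, zero_mul, zero_add]
  refine sum_congr rfl fun p _ => ?_
  push_cast
  ring

lemma altSum_succ (m : ℕ) : altSum χ (m + 1) = χ ((m + 1 : ℕ) : ZMod k) - altSum χ m := by
  rw [altSum, Nat.sum_antidiagonal_succ', altSum, sub_eq_add_neg, ← sum_neg_distrib]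
  simp only [pow_zero, one_mul]
  congr 1
  refine sum_congr rfl fun p _ => ?_
  ring

lemma sum_choose_mul_altConv_reflect (a β : ℕ) :
    ∑ r ∈ range (a + 1), (a.choose r : ℂ) * altConv χ (β * (2 * r - a))
      = ∑ r ∈ range (a + 1), (a.choose r : ℂ) * altConv χ (β * (a - 2 * r)) := by
  rw [← sum_flip]
  refine sum_congr rfl fun r hr => ?_
  have hra := Nat.lt_succ_iff.mp (mem_range.mp hr)
  rw [Nat.choose_symm hra]
  congr 3
  omega

lemma E_eq_sum_altConv {β : ℕ} (hβ : 0 < β) (a : ℕ) :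
    E a (2 * β) χ = 4 / 2 ^ a * ∑ r ∈ range (a + 1),
      (a.choose r : ℂ) * altConv χ (β * (a - 2 * r)) := by
  have h4 : 1 / (2 : ℂ) ^ ((a : ℤ) - 2) = 4 / 2 ^ a := by
    rw [zpow_sub₀ two_ne_zero, zpow_natCast, one_div_div]; norm_num
  have hmem (p : ℕ × ℕ × ℕ) :
      p ∈ triples a (2 * β) ↔ p.1 + p.2.1 + β * (2 * p.2.2) = β * a := by
    obtain ⟨n, j, r⟩ := p
    rw [mem_triples (by omega)]
    constructor <;> intro h <;> nlinarith
  have hle {p : ℕ × ℕ × ℕ} (hp : p ∈ triples a (2 * β)) : 2 * p.2.2 ≤ a := by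
    have := (hmem p).mp hp
    exact le_of_mul_le_mul_left (by omega) hβ
  rw [E, h4]
  congr 1
  rw [← sum_fiberwise_of_maps_to (t := range (a + 1)) (g := fun p => p.2.2)
    (fun p hp => by have := hle hp; rw [mem_range]; omega)]
  refine sum_congr rfl fun r _ => ?_
  rcases le_or_gt (2 * r) a with hr | hr
  · have hb : β * (a - 2 * r) + β * (2 * r) = β * a := by
      rw [← mul_add, Nat.sub_add_cancel hr]
    rw [altConv, mul_sum]
    refine sum_bij' (fun p _ => (p.1, p.2.1)) (fun p _ => (p.1, p.2, r)) ?_ ?_ ?_ ?_ ?_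
    · rintro ⟨n, j, s⟩ hp
      simp only [mem_filter, hmem] at hp
      rw [hp.2] at hp
      simp only [HasAntidiagonal.mem_antidiagonal]
      omega
    · rintro ⟨n, j⟩ hp
      simp only [HasAntidiagonal.mem_antidiagonal] at hp
      simp only [mem_filter, hmem, and_true]
      omega
    · rintro ⟨n, j, s⟩ hp
      rw [← (mem_filter.mp hp).2]
    · intro p _; rfl
    · rintro ⟨n, j, s⟩ hp
      rw [← (mem_filter.mp hp).2]
      ring
  -- The fibre over such `r` is empty, matching `altConv χ 0 = 0` under truncated subtraction.
  · rw [Nat.sub_eq_zero_of_le hr.le, mul_zero, altConv_zero, mul_zero]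
    refine sum_eq_zero fun p hp => ?_
    have hp := mem_filter.mp hp
    have := hle hp.1
    omega

end Convolutions

/-! ### The recurrence for the twisted sums -/

section TwistedSum

variable {k : ℕ} [NeZero k]

/-- The weight `1 / cos² (π x / k)` on `ZMod k`, written in terms of additive characters. -/
noncomputable def secSq (x : ZMod k) : ℂ := 4 / (2 + stdAddChar x + stdAddChar (-x))

lemma secSq_neg (x : ZMod k) : secSq (-x) = secSq x := by
  rw [secSq, secSq, neg_neg, add_right_comm]

/-- Vanishing would force e(x/k) = -1, which is no k-th root of unity for odd k. -/
lemma secSq_denom_ne_zero (hk : Odd k) (x : ZMod k) :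
    2 + stdAddChar x + stdAddChar (-x) ≠ 0 := by
  have hmul : stdAddChar x * stdAddChar (-x) = 1 := by
    rw [← AddChar.map_add_eq_mul, add_neg_cancel, AddChar.map_zero_eq_one]
  intro h
  have hz : stdAddChar x = -1 := by
    have : (stdAddChar x + 1) ^ 2 = 0 := by linear_combination stdAddChar x * h - hmul
    exact eq_neg_of_add_eq_zero_left (pow_eq_zero_iff two_ne_zero |>.mp this)
  have hp : stdAddChar x ^ k = 1 := by
    rw [← AddChar.map_nsmul_eq_pow]; simp
  rw [hz, hk.neg_one_pow] at hp
  norm_num at hp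

/-- The sum `½ ∑ χ(x) e(mx/k) / cos²(πx/k)` over residue classes `x`. -/
noncomputable def twistedSum (χ : DirichletCharacter ℂ k) (m : ZMod k) : ℂ :=
  1 / 2 * ∑ x, χ x * (stdAddChar (m * x) * secSq x)

variable {χ : DirichletCharacter ℂ k}

lemma twistedSum_neg (heven : χ.Even) (m : ZMod k) : twistedSum χ (-m) = twistedSum χ m := by
  rw [twistedSum, twistedSum, ← Equiv.sum_comp (Equiv.neg (ZMod k))]
  simp only [Equiv.neg_apply, neg_mul_neg, secSq_neg, heven.eval_neg]

lemma twistedSum_recurrence (hk : Odd k) (hreal : ∀ x, (χ x).im = 0) (heven : χ.Even)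
    (hprim : χ.IsPrimitive) (m : ZMod k) :
    twistedSum χ (m + 1) + 2 * twistedSum χ m + twistedSum χ (m - 1)
      = 2 * ((Real.sqrt k : ℝ) : ℂ) * χ m := by
  rw [mul_assoc, mul_comm _ (χ m), ← gaussSum_real_eq_sqrt hk hreal heven hprim,
    ← gaussSum_mulShift_real hreal hprim]
  simp only [twistedSum, mul_sum, ← sum_add_distrib]
  refine sum_congr rfl fun x _ => ?_
  have hd := secSq_denom_ne_zero hk x
  rw [add_mul, sub_eq_add_neg, add_mul, AddChar.map_add_eq_mul, AddChar.map_add_eq_mul, one_mul,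
    neg_one_mul, secSq]
  field_simp
  ring

lemma char_zero_eq_zero (hχ : χ ≠ 1) : χ 0 = 0 := by
  apply χ.map_zero'
  rintro rfl
  exact hχ (DirichletCharacter.level_one χ)

/-- The second-order recurrence splits into two first-order ones, proved jointly; T(-1) = T(1)
supplies the initial condition. -/
lemma twistedSum_natCast (hk : Odd k) (hreal : ∀ x, (χ x).im = 0) (hχ : χ ≠ 1) (heven : χ.Even)
    (hprim : χ.IsPrimitive) (m : ℕ) :
    twistedSum χ (m : ZMod k)
        = (-1) ^ m * twistedSum χ 0 - 2 * ((Real.sqrt k : ℝ) : ℂ) * altConv χ m ∧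
      twistedSum χ ((m : ZMod k) + 1) + twistedSum χ (m : ZMod k)
        = 2 * ((Real.sqrt k : ℝ) : ℂ) * altSum χ m := by
  induction m with
  | zero =>
    refine ⟨by simp [altConv_zero], ?_⟩
    have h := twistedSum_recurrence hk hreal heven hprim 0
    rw [zero_sub, twistedSum_neg heven, char_zero_eq_zero hχ] at h
    simp only [Nat.cast_zero, zero_add] at h ⊢
    have h0 : altSum χ 0 = 0 := by simp [altSum, char_zero_eq_zero hχ]
    rw [h0]
    linear_combination h / 2
  | succ m ih =>
    obtain ⟨ih1, ih2⟩ := ih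
    have h := twistedSum_recurrence hk hreal heven hprim ((m : ZMod k) + 1)
    rw [add_sub_cancel_right] at h
    rw [altConv_succ, altSum_succ]
    push_cast
    constructor
    · linear_combination ih2 - ih1
    · linear_combination h - ih2

lemma altConv_level_eq_g (hχ : χ ≠ 1) (heven : χ.Even) : altConv χ k = g χ := by
  rw [altConv, ← Nat.sum_antidiagonal_swap, Nat.sum_antidiagonal_eq_sum_range_succ_mk, sum_range_succ, g, range_eq_Ico,
    sum_eq_sum_Ico_succ_bot (NeZero.pos k)]
  simp only [Prod.snd_swap, Prod.fst_swap]
  simp only [Nat.cast_zero, mul_zero, zero_mul, zero_add, Nat.sub_self,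
    char_zero_eq_zero hχ, add_zero]
  refine sum_congr rfl fun j hj => ?_
  rw [Nat.cast_sub (mem_Ico.mp hj).2.le, natCast_self, zero_sub, heven.eval_neg]

lemma twistedSum_zero (hk : Odd k) (hreal : ∀ x, (χ x).im = 0) (hχ : χ ≠ 1) (heven : χ.Even)
    (hprim : χ.IsPrimitive) :
    twistedSum χ 0 = -((Real.sqrt k : ℝ) : ℂ) * g χ := by
  have h := (twistedSum_natCast hk hreal hχ heven hprim k).1
  rw [natCast_self, hk.neg_one_pow, altConv_level_eq_g hχ heven] at h
  linear_combination h / 2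

/-- At most one truncated difference is nonzero and `altConv χ 0 = 0`, so the bracket is `altConv`
at β|a - 2r|; this covers negative indices because T is even. -/
lemma twistedSum_symm_index (hk : Odd k) (hreal : ∀ x, (χ x).im = 0) (hχ : χ ≠ 1)
    (heven : χ.Even) (hprim : χ.IsPrimitive) (β a r : ℕ) :
    twistedSum χ ((β : ZMod k) * (a - 2 * r))
      = (-1) ^ (a * β) * twistedSum χ 0
        - 2 * ((Real.sqrt k : ℝ) : ℂ) 
          * (altConv χ (β * (a - 2 * r)) + altConv χ (β * (2 * r - a))) := by
  rcases le_total (2 * r) a with h | h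
  · obtain ⟨d, rfl⟩ := Nat.exists_eq_add_of_le h
    have h1 : (β : ZMod k) * (((2 * r + d : ℕ) : ZMod k) - 2 * r) = ((β * d : ℕ) : ZMod k) := by
      push_cast; ring
    have h2 : ((-1 : ℂ)) ^ ((2 * r + d) * β) = (-1) ^ (β * d) := by
      rw [add_mul, pow_add, mul_assoc, pow_mul]; simp [mul_comm]
    rw [h1, (twistedSum_natCast hk hreal hχ heven hprim _).1, h2, Nat.add_sub_cancel_left,
      Nat.sub_eq_zero_of_le (Nat.le_add_right _ _), mul_zero, altConv_zero, add_zero]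
  · obtain ⟨d, hd⟩ := Nat.exists_eq_add_of_le h
    have hd' : (2 * r : ZMod k) = a + d := by exact_mod_cast congrArg (Nat.cast : ℕ → ZMod k) hd
    have h1 : (β : ZMod k) * ((a : ZMod k) - 2 * r) = -((β * d : ℕ) : ZMod k) := by
      rw [hd']; push_cast; ring
    have h2 : ((-1 : ℂ)) ^ (a * β) = (-1) ^ (β * d) := by
      have : (-1 : ℂ) ^ (a * β) * (-1) ^ (β * d) = 1 := by
        rw [← pow_add, mul_comm β, ← add_mul, ← hd, mul_assoc, pow_mul]; simp
      rcases neg_one_pow_eq_or ℂ (a * β) with h | h <;>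
        rcases neg_one_pow_eq_or ℂ (β * d) with h' | h' <;> rw [h, h'] at this ⊢ <;> norm_num at this
    rw [h1, twistedSum_neg heven, (twistedSum_natCast hk hreal hχ heven hprim _).1, h2,
      Nat.sub_eq_zero_of_le h, hd, Nat.add_sub_cancel_left, mul_zero, altConv_zero, zero_add]

end TwistedSum

/-! ### Expanding `S₁` in twisted sums -/

section Expansion

variable {k : ℕ} [NeZero k]

lemma stdAddChar_add_neg_eq_cos (m : ℕ) :
    stdAddChar (m : ZMod k) + stdAddChar (-(m : ZMod k))
      = 2 * (Real.cos (2 * Real.pi * m / k) : ℂ) := by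
  have h1 := stdAddChar_coe (N := k) (m : ℤ)
  have h2 := stdAddChar_coe (N := k) (-(m : ℤ))
  push_cast at h1 h2
  rw [h1, h2, Complex.ofReal_cos, Complex.cos]
  push_cast
  rw [mul_div_cancel₀ _ two_ne_zero]
  congr 2 <;> ring

lemma secSq_natCast (n : ℕ) :
    secSq (n : ZMod k) = ((1 / Real.cos (Real.pi * n / k) ^ 2 : ℝ) : ℂ) := by
  rw [secSq, add_assoc, stdAddChar_add_neg_eq_cos]
  have : 2 * Real.pi * n / k = 2 * (Real.pi * n / k) := by ring
  rw [this, Real.cos_two_mul]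
  push_cast
  rw [show (2 : ℂ) + 2 * (2 * Complex.cos (Real.pi * n / k) ^ 2 - 1)
    = 4 * Complex.cos (Real.pi * n / k) ^ 2 by ring]
  rw [div_mul_eq_div_div, div_self (by norm_num)]

lemma sum_even_eq_two_mul_sum_half {h : ℕ} (hk : k = 2 * h + 1) {f : ZMod k → ℂ}
    (hf : ∀ x, f (-x) = f x) (h0 : f 0 = 0) :
    ∑ x, f x = 2 * ∑ n ∈ range h, f ((n + 1 : ℕ) : ZMod k) := by
  have hr : range k = range (h + h + 1) := by rw [hk, two_mul]
  rw [sum_zmod_eq_sum_range, hr, sum_range_succ', sum_range_add, Nat.cast_zero, h0, add_zero,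
    two_mul]
  congr 1
  rw [← sum_range_reflect]
  refine sum_congr rfl fun n hn => ?_
  rw [← hf]
  congr 1
  rw [neg_eq_iff_add_eq_zero, ← Nat.cast_add]
  have : h + (h - 1 - n) + 1 + (n + 1) = k := by have := mem_range.mp hn; omega
  rw [this, natCast_self]

lemma S₁_eq_sum_zmod {χ : DirichletCharacter ℂ k} (hk : Odd k) (hχ : χ ≠ 1) (heven : χ.Even)
    (a β : ℕ) :
    S₁ a (2 * β) χ = 1 / 2 * ∑ x, χ x *
      (((stdAddChar (-((β : ZMod k) * x)) + stdAddChar ((β : ZMod k) * x)) / 2) ^ a * secSq x) := by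
  obtain ⟨h, hh⟩ := hk
  rw [sum_even_eq_two_mul_sum_half hh, ← mul_assoc]
  · have hs : (range k).filter (fun n : ℕ => 0 < n ∧ (n : ℝ) < (k : ℝ) / 2) = Ico 1 (h + 1) := by
      ext n
      have : (n : ℝ) < (k : ℝ) / 2 ↔ 2 * n < k := by
        rw [lt_div_iff₀ two_pos, mul_comm]; exact_mod_cast Iff.rfl
      simp only [mem_filter, mem_range, mem_Ico, this]
      omega
    rw [S₁, hs, sum_Ico_eq_sum_range]
    norm_num only [one_mul]
    refine sum_congr (by simp) fun n _ => ?_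
    rw [add_comm 1 n, secSq_natCast, ← Nat.cast_mul, add_comm (stdAddChar _),
      stdAddChar_add_neg_eq_cos, mul_div_cancel_left₀ _ two_ne_zero, ← Complex.ofReal_pow,
      ← Complex.ofReal_mul]
    congr 2
    rw [mul_one_div]
    push_cast
    congr 3
    ring
  · intro x
    rw [heven.eval_neg, secSq_neg, mul_neg, neg_neg, add_comm]
  · rw [char_zero_eq_zero hχ, zero_mul]

lemma S₁_eq_sum_twistedSum {χ : DirichletCharacter ℂ k} (hk : Odd k) (hχ : χ ≠ 1)
    (heven : χ.Even) (a β : ℕ) :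
    S₁ a (2 * β) χ = 1 / 2 ^ a * ∑ r ∈ range (a + 1),
      (a.choose r : ℂ) * twistedSum χ ((β : ZMod k) * (a - 2 * r)) := by
  rw [S₁_eq_sum_zmod hk hχ heven]
  simp only [twistedSum, mul_sum]
  rw [sum_comm]
  refine sum_congr rfl fun x _ => ?_
  rw [div_pow, add_pow, sum_div, sum_mul, mul_sum, mul_sum]
  refine sum_congr rfl fun r hr => ?_
  have : stdAddChar (-((β : ZMod k) * x)) ^ r * stdAddChar ((β : ZMod k) * x) ^ (a - r)
      = stdAddChar ((β : ZMod k) * ((a : ZMod k) - 2 * (r : ZMod k)) * x) := by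
    rw [← AddChar.map_nsmul_eq_pow, ← AddChar.map_nsmul_eq_pow, ← AddChar.map_add_eq_mul]
    congr 1
    rw [nsmul_eq_mul, nsmul_eq_mul, Nat.cast_sub (Nat.lt_succ_iff.mp (mem_range.mp hr))]
    ring
  rw [this]
  ring

end Expansion

end CosCharSum

theorem theorem2p1 (k : ℕ) (hk : Odd k) (χ : DirichletCharacter ℂ k)
    (hreal : ∀ x : ZMod k, (χ x).im = 0) (hnonprincipal : χ ≠ 1)
    (heven : χ.Even) (hprim : χ.IsPrimitive)
    (a b : ℕ) (hb_pos : 0 < b) (hb_even : Even b) :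
    CosCharSum.S₁ a b χ =
      -((Real.sqrt (k : ℝ) : ℝ) : ℂ) *
        ((-1 : ℂ) ^ (a * b / 2) * CosCharSum.g χ + CosCharSum.E a b χ) := by
  have : NeZero k := ⟨hk.pos.ne'⟩
  obtain ⟨β, rfl⟩ := hb_even.exists_two_nsmul
  rw [smul_eq_mul] at hb_pos ⊢
  have hexp : a * (2 * β) / 2 = a * β := by
    rw [mul_left_comm, Nat.mul_div_cancel_left _ two_pos]
  have hchoose : ∑ r ∈ Finset.range (a + 1), (a.choose r : ℂ) = 2 ^ a := by
    exact_mod_cast Nat.sum_range_choose a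
  have h2 : (2 : ℂ) ^ a ≠ 0 := pow_ne_zero _ two_ne_zero
  rw [CosCharSum.S₁_eq_sum_twistedSum hk hnonprincipal heven,
    CosCharSum.E_eq_sum_altConv (by omega), hexp]
  have hsum : ∑ r ∈ Finset.range (a + 1),
      (a.choose r : ℂ) * CosCharSum.twistedSum χ ((β : ZMod k) * (a - 2 * r))
        = 2 ^ a * ((-1) ^ (a * β) * CosCharSum.twistedSum χ 0)
          - 4 * ((Real.sqrt k : ℝ) : ℂ) * ∑ r ∈ Finset.range (a + 1),
            (a.choose r : ℂ) * CosCharSum.altConv χ (β * (a - 2 * r)) := by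
    have hrefl := CosCharSum.sum_choose_mul_altConv_reflect (χ := χ) a β
    rw [← hchoose, Finset.sum_mul]
    -- The two `altConv` sums agree under r ↦ a - r, whence 4 = 2 · 2.
    rw [show (4 : ℂ) * ((Real.sqrt k : ℝ) : ℂ) = 2 * ((Real.sqrt k : ℝ) : ℂ) * 2 by ring,
      mul_assoc _ 2, two_mul (Finset.sum _ _)]
    nth_rw 2 [← hrefl]
    rw [← Finset.sum_add_distrib, Finset.mul_sum, ← Finset.sum_sub_distrib]
    refine Finset.sum_congr rfl fun r _ => ?_
    rw [CosCharSum.twistedSum_symm_index hk hreal hnonprincipal heven hprim]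
    ring
  rw [hsum, CosCharSum.twistedSum_zero hk hreal hnonprincipal heven hprim]
  field_simp
  ring
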